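/- **Setting.** Fix countably infinite sets $\mathcal I$ (identifiers), $\Lambda$ (types), $\mathcal V$ (variables), pairwise disjoint infinite sets $I(\lambda)\subseteq\mathcal I$ $(\lambda\in\Lambda)$, a map $\mathrm{type}:\mathcal I\to\Lambda$ with $\mathrm{id}\in I(\mathrm{type}(\mathrm{id}))$, and a map $\mathrm{type}:\mathcal V\to\Lambda$; typings extend to vectors entrywise. A *t-PNID* $L=(P,T,F,\alpha,\beta)$ has places $P$, transitions $T$, a flow relation $F\subseteq (P\times T)\cup(T\times P)$, a place typing $\alpha:P\to\Lambda^*$, and for every $f\in F$ a nonempty finite multiset $\beta(f)$ of variable vectors, all of type $\alpha(q)$ where $q$ is the place of $f$; put $\beta(f)=\emptyset$ for $f\notin F$. A *marking* assigns to each place $q$ a finite multiset of identifier vectors of type $\alpha(q)$; $\mathrm{Id}(M)$ is the set of identifiers occurring in $M$. For $t\in T$ let $\mathrm{In}(t)$, $\mathrm{Out}(t)$ be the sets of variables on its input and output arcs, $\mathrm{New}(t)=\mathrm{Out}(t)\setminus \mathrm{In}(t)$ and $\mathrm{Del}(t)=\mathrm{In}(t)\setminus \mathrm{Out}(t)$.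 A *binding* for $t$ in $M$ is an injective type-preserving $\psi:\mathcal V\to\mathcal I$ such that, for every variable $v\in\mathrm{In}(t)\cup\mathrm{Out}(t)$, $\psi(v)\notin\mathrm{Id}(M)$ iff $v\in\mathrm{New}(t)$. Write $\psi(\beta(f))$ for the multiset obtained by applying $\psi$ to all entries. The transition $t$ is enabled in $M$ under $\psi$ if $\psi(\beta(q,t))\le M(q)$ for all $q\in P$; firing it gives $M'$ with $M'(q)+\psi(\beta(q,t))=M(q)+\psi(\beta(t,q))$ for all $q$. Reachability is by finite firing sequences. A marked t-PNID $(L,M_0)$ is *live* if from every reachable marking and for every transition $t$ a marking is reachable in which $t$ is enabled under some binding. It is *identifier sound* if for every type $\lambda$ occurring in some $\alpha(q)$: (i) whenever $M,M'$ are reachable, $t$ has a variable of type $\lambda$ in $\mathrm{Del}(t)$, and $t$ fires from $M$ to $M'$ under $\psi$, every identifier of type $\lambda$ in $\psi(\mathrm{Del}(t))\cap\mathrm{Id}(M)$ is not in $\mathrm{Id}(M')$; and (ii) for every reachable $M$ and $\mathrm{id}\in I(\lambda)\cap \mathrm{Id}(M)$ some marking $M'$ reachable from $M$ has $\mathrm{id}\notin\mathrm{Id}(M')$.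 A *WF-net* $N=(P_N,T_N,F_N,W_N,\mathit{in},\mathit{out})$ is a weighted Petri net ($W_N(f)>0$ iff $f\in F_N$) with finitely many places, where $\mathit{in}$ has no incoming arc, $\mathit{out}$ has no outgoing arc, and every node is on a directed path from $\mathit{in}$ to $\mathit{out}$. It is *generalized sound* if for every $k\in\mathbb N$: every marking $m$ reachable from $[\mathit{in}^k]$ with $[\mathit{out}^k]\le m$ equals $[\mathit{out}^k]$; $[\mathit{out}^k]$ is reachable from every marking reachable from $[\mathit{in}^k]$; and every transition is enabled in some marking reachable from $[\mathit{in}]$. Let $p$ be a place of $L$ and let $\vec\mu\in\mathcal V^*$ have type $\alpha(p)$. The *workflow refinement* $L\oplus_pN$ (with inscription $\vec\mu$) has as places the disjoint union of $P\setminus\{p\}$ and $P_N$ and as transitions the disjoint union of $T$ and $T_N$. The places of $P\setminus\{p\}$, and the arcs between them and $T$, keep their types and inscriptions; every place of $N$ has type $\alpha(p)$; each arc $f\in F_N$ is inscribed with $[\vec\mu^{\,W_N(f)}]$; each arc $(t,p)$ of $L$ becomes $(t,\mathit{in})$ and each arc $(p,t)$ becomes $(\mathit{out},t)$, with the same inscription.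 A marking $M$ of $L$ is read as the marking $\widehat M$ of $L\oplus_p N$ with $\widehat M(q)=M(q)$ for $q\in P\setminus\{p\}$, $\widehat M(\mathit{in})=M(p)$, and no tokens on the other places of $N$ (so if $M(p)=\emptyset$, then $\widehat M$ is $M$ with all places of $N$ empty). **Theorem.** Let $(L,M)$ be a marked t-PNID, $p$ a place of $L$ with at least one incoming or outgoing arc, $N$ a generalized sound WF-net, and $\vec\mu\in\mathcal V^*$ a vector of type $\alpha(p)$. Assume that $\vec\mu$ fits the tokens of $p$ up to injective renaming: every variable vector in the inscription of an arc $(t,p)$ is the image of $\vec\mu$ under an injective map $\mathcal V\to\mathcal V$, and every token of $M(p)$ (if any) is the image of $\vec\mu$ under an injective type-preserving map $\mathcal V\to\mathcal I$. (For instance, this holds when $M(p)=\emptyset$ and neither $\vec\mu$ nor any vector on an arc into $p$ repeats a variable.) Then $(L,M)$ is identifier sound and live if and only if $(L\oplus_pN,\widehat M)$ is identifier sound and live. -/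

import Mathlib

/-! ### Weighted Petri nets and workflow nets -/

/-- A weighted Petri net with places `P` and transitions `T`.  The flow relation `F` consists
of the arcs of positive weight: `(p, t) ∈ F` iff `0 < wIn p t`, `(t, p) ∈ F` iff `0 < wOut t p`. -/
structure PetriNet (P T : Type*) where
  /-- the weight `W (p, t)` -/
  wIn : P → T → ℕ
  /-- the weight `W (t, p)` -/
  wOut : T → P → ℕ

namespace PetriNet

variable {P T : Type*} (N : PetriNet P T)

/-- `t` is enabled in the marking `m`; markings are finite multisets of places. -/
def Enabled (m : P →₀ ℕ) (t : T) : Prop :=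
  ∀ p, N.wIn p t ≤ m p

/-- Firing `t` in `m` results in `m'`. -/
def Fires (m : P →₀ ℕ) (t : T) (m' : P →₀ ℕ) : Prop :=
  N.Enabled m t ∧ ∀ p, m' p + N.wIn p t = m p + N.wOut t p

/-- `m'` is reachable from `m` by a finite firing sequence. -/
def Reachable (m m' : P →₀ ℕ) : Prop :=
  Relation.ReflTransGen (fun a b => ∃ t, N.Fires a t b) m m'

/-- The flow relation, as a directed graph on the nodes `P ∪ T`. -/
def Flow : P ⊕ T → P ⊕ T → Prop
  | Sum.inl p, Sum.inr t => 0 < N.wIn p t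
  | Sum.inr t, Sum.inl p => 0 < N.wOut t p
  | _, _ => False

end PetriNet

/-- A workflow net: a weighted Petri net with a source and a sink place. -/
structure WFNet (P T : Type*) extends PetriNet P T where
  /-- the source place -/
  source : P
  /-- the sink place -/
  sink : P
  source_preset : ∀ t, wOut t source = 0
  sink_postset : ∀ t, wIn sink t = 0
  /-- every node lies on a directed path from the source to the sink -/
  on_path : ∀ x : P ⊕ T,
    Relation.ReflTransGen toPetriNet.Flow (Sum.inl source) x ∧
      Relation.ReflTransGen toPetriNet.Flow x (Sum.inl sink)

namespace WFNet

variable {P T : Type*} (N : WFNet P T)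

/-- `k`-soundness: proper completion, weak termination and quasi-liveness. -/
def KSound (k : ℕ) : Prop :=
  (∀ m, N.Reachable (Finsupp.single N.source k) m →
      Finsupp.single N.sink k ≤ m → m = Finsupp.single N.sink k) ∧
  (∀ m, N.Reachable (Finsupp.single N.source k) m →
      N.Reachable m (Finsupp.single N.sink k)) ∧
  (∀ t, ∃ m, N.Reachable (Finsupp.single N.source 1) m ∧ N.Enabled m t)

/-- Generalized soundness: `k`-soundness for all `k`. -/
def GeneralizedSound : Prop :=
  ∀ k : ℕ, N.KSound k

end WFNet

/-! ### Typed Petri nets with identifiers -/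

/-- Identifiers `I`, type labels `Λ` and variables `V` with their typing functions. -/
structure IdTyping (I Λ V : Type*) where
  /-- the domain assignment -/
  dom : Λ → Set I
  dom_infinite : ∀ l, (dom l).Infinite
  dom_disjoint : ∀ l₁ l₂, (dom l₁ ∩ dom l₂).Nonempty → l₁ = l₂
  /-- the id typing function -/
  typeI : I → Λ
  mem_dom : ∀ i, i ∈ dom (typeI i)
  /-- the variable typing function -/
  typeV : V → Λ

/-- A substitution of variables by identifiers that is injective and respects the types. -/
def IdTyping.IsSubst {I Λ V : Type*} (D : IdTyping I Λ V) (ψ : V → I) : Prop :=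
  Function.Injective ψ ∧ ∀ v, D.typeV v = D.typeI (ψ v)

/-- A typed Petri net with identifiers.  The inscription `β` is extended by the empty multiset
to all pairs, and the flow relation consists of the arcs with a nonempty inscription. -/
structure TPNID {I Λ V : Type*} (D : IdTyping I Λ V) (P T : Type*) where
  /-- the place typing `α` -/
  placeType : P → List Λ
  /-- the inscription `β (p, t)` -/
  βIn : P → T → Multiset (List V)
  /-- the inscription `β (t, p)` -/
  βOut : T → P → Multiset (List V)
  βIn_type : ∀ p t, ∀ x ∈ βIn p t, x.map D.typeV = placeType p
  βOut_type : ∀ t p, ∀ x ∈ βOut t p, x.map D.typeV = placeType p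

/-- Replacing the variables by identifiers in a multiset of variable vectors. -/
def substVectors {V I : Type*} (ψ : V → I) (b : Multiset (List V)) : Multiset (List I) :=
  b.map (List.map ψ)

namespace TPNID

variable {I Λ V : Type*} {D : IdTyping I Λ V} {P T : Type*} (N : TPNID D P T)

/-- The id set `C(p)`: the identifier vectors that `p` may carry. -/
def idSet (p : P) : Set (List I) :=
  {c | List.Forall₂ (fun i l => i ∈ D.dom l) c (N.placeType p)}

/-- `M` is a marking of the net. -/
def IsMarking (M : P → Multiset (List I)) : Prop :=
  ∀ p, ∀ c ∈ M p, c ∈ N.idSet p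

/-- The set of identifiers used in a marking. -/
def ids (M : P → Multiset (List I)) : Set I :=
  {i | ∃ p, ∃ c ∈ M p, i ∈ c}

/-- Input variables of `t`. -/
def inVar (t : T) : Set V := {v | ∃ p, ∃ x ∈ N.βIn p t, v ∈ x}

/-- Output variables of `t`. -/
def outVar (t : T) : Set V := {v | ∃ p, ∃ x ∈ N.βOut t p, v ∈ x}

/-- Variables of `t`. -/
def var (t : T) : Set V := N.inVar t ∪ N.outVar t

/-- Emitting variables of `t`. -/
def newVar (t : T) : Set V := N.outVar t \ N.inVar t

/-- Collecting variables of `t`. -/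
def delVar (t : T) : Set V := N.inVar t \ N.outVar t

/-- The collecting transitions of a type. -/
def collectors (l : Λ) : Set T := {t | ∃ x ∈ N.delVar t, D.typeV x = l}

/-- The object types of the net. -/
def objectTypes : Set Λ := {l | ∃ p, l ∈ N.placeType p}

/-- `ψ` is a binding for `t` in the marking `M`: injective, type-respecting, and among the
variables of `t` exactly the emitting ones take identifiers that are fresh for `M`. -/
def IsBinding (M : P → Multiset (List I)) (t : T) (ψ : V → I) : Prop :=
  D.IsSubst ψ ∧ ∀ v ∈ N.var t, (ψ v ∉ ids M ↔ v ∈ N.newVar t)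

/-- `t` is enabled in `M` under the binding `ψ`. -/
def Enabled (M : P → Multiset (List I)) (t : T) (ψ : V → I) : Prop :=
  N.IsBinding M t ψ ∧ ∀ p, substVectors ψ (N.βIn p t) ≤ M p

/-- Firing `t` under `ψ` in `M` results in `M'`. -/
def Fires (M : P → Multiset (List I)) (t : T) (ψ : V → I) (M' : P → Multiset (List I)) : Prop :=
  N.Enabled M t ψ ∧
    ∀ p, M' p + substVectors ψ (N.βIn p t) = M p + substVectors ψ (N.βOut t p)

/-- `M'` is reachable from `M` by a finite firing sequence. -/
def Reachable (M M' : P → Multiset (List I)) : Prop :=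
  Relation.ReflTransGen (fun A B => ∃ t ψ, N.Fires A t ψ B) M M'

/-- Liveness of the marked net `(N, M₀)`. -/
def Live (M₀ : P → Multiset (List I)) : Prop :=
  ∀ M, N.Reachable M₀ M → ∀ t, ∃ M' ψ, N.Reachable M M' ∧ N.Enabled M' t ψ

/-- Proper type completion. -/
def ProperlyCompleting (M₀ : P → Multiset (List I)) (l : Λ) : Prop :=
  ∀ t ∈ N.collectors l, ∀ (ψ : V → I) (m m' : P → Multiset (List I)),
    N.Reachable M₀ m → N.Reachable M₀ m' → N.Fires m t ψ m' →
      ∀ i ∈ (ψ '' N.delVar t) ∩ ids m, D.typeI i = l → i ∉ ids m'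

/-- Weak type termination. -/
def WeaklyTerminating (M₀ : P → Multiset (List I)) (l : Λ) : Prop :=
  ∀ m, N.Reachable M₀ m → ∀ i ∈ D.dom l, i ∈ ids m → ∃ m', N.Reachable m m' ∧ i ∉ ids m'

/-- Identifier soundness: proper completion and weak termination for every object type. -/
def IdentifierSound (M₀ : P → Multiset (List I)) : Prop :=
  ∀ l ∈ N.objectTypes, N.ProperlyCompleting M₀ l ∧ N.WeaklyTerminating M₀ l

end TPNID

/-! ### Workflow refinement -/

section Refinement

variable {I Λ V : Type*} {D : IdTyping I Λ V} {PL TL PN TN : Type*}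

/-- The workflow refinement `L ⊕ₚ N` with inscription vector `μ`.  Its places are those of `L`
other than `p` together with those of `N`, its transitions are those of `L` and those of `N`.
Transitions of `L` that produce in `p` now produce in the source of `N`, and those that
consume from `p` consume from the sink of `N`. -/
noncomputable def TPNID.wfRefine (L : TPNID D PL TL) (p : PL) (N : WFNet PN TN) (μ : List V)
    (hμ : μ.map D.typeV = L.placeType p) :
    TPNID D ({q : PL // q ≠ p} ⊕ PN) (TL ⊕ TN) where
  placeType
    | Sum.inl q => L.placeType q.1
    | Sum.inr _ => L.placeType p
  βIn
    | Sum.inl q, Sum.inl t => L.βIn q.1 t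
    | Sum.inl _, Sum.inr _ => 0
    | Sum.inr q, Sum.inl t => open Classical in if q = N.sink then L.βIn p t else 0
    | Sum.inr q, Sum.inr t => Multiset.replicate (N.wIn q t) μ
  βOut
    | Sum.inl t, Sum.inl q => L.βOut t q.1
    | Sum.inr _, Sum.inl _ => 0
    | Sum.inl t, Sum.inr q => open Classical in if q = N.source then L.βOut t p else 0
    | Sum.inr t, Sum.inr q => Multiset.replicate (N.wOut t q) μ
  βIn_type := by
    rintro (q | q) (t | t) x hx
    · exact L.βIn_type _ _ x hx
    · simp at hx
    · dsimp only at hx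
      split_ifs at hx
      · exact L.βIn_type _ _ x hx
      · simp at hx
    · rw [Multiset.eq_of_mem_replicate hx]
      exact hμ
  βOut_type := by
    rintro (t | t) (q | q) x hx
    · exact L.βOut_type _ _ x hx
    · dsimp only at hx
      split_ifs at hx
      · exact L.βOut_type _ _ x hx
      · simp at hx
    · simp at hx
    · rw [Multiset.eq_of_mem_replicate hx]
      exact hμ

/-- The marking `M` of `L`, read as a marking of the refinement: the tokens of `p`, if any, are
put in the source of `N`, and all other places of `N` are empty.  If `M p = 0`, this is `M`
on the places of `L` other than `p` and empty on the places of `N`. -/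
noncomputable def wfRefineMarking (p : PL) (N : WFNet PN TN) (M : PL → Multiset (List I)) :
    {q : PL // q ≠ p} ⊕ PN → Multiset (List I)
  | Sum.inl q => M q.1
  | Sum.inr q => open Classical in if q = N.source then M p else 0

end Refinement

/-! ### Firing sequences of Petri nets -/

namespace PetriNet

variable {P T : Type*} {N : PetriNet P T}

/-! Arcs of `N` carry only copies of `μ`, so an inner transition fired under `ψ` moves only tokens
of colour `μ.map ψ`: the places of `N` split into independent uncoloured copies of `N`, one per
colour. `Represents` relates a marking of the refinement to one of `L` when they agree outside `p`
and, for each colour, the copy of `N` is a possible state of as many running cases as `p` has tokens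
of that colour. The hypotheses on `μ` ensure that `N` can move every such token.

Generalized soundness makes this relation a simulation in both directions, up to inner steps.
Running cases can be completed (`reachable_sink`), the sink never offers more tokens than `p`
(`le_of_single_le`), and a copy is empty exactly when `p` lacks the colour (`eq_zero_iff`), so both
markings have the same identifiers and hence the same bindings. Outer steps preserve the relation by
`exchange`; inner steps leave the marking of `L` unchanged. Identifier soundness and liveness of
outer transitions transfer along the relation; liveness of inner transitions follows from
quasi-liveness of `N` once a token is put in the source. -/

theorem Fires.add_right {m m' : P →₀ ℕ} {t : T} (h : N.Fires m t m') (x : P →₀ ℕ) :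
    N.Fires (m + x) t (m' + x) := by
  refine ⟨fun p => (h.1 p).trans (by simp), fun p => ?_⟩
  have := h.2 p
  simp only [Finsupp.add_apply]
  omega

theorem Reachable.add_right {m m' : P →₀ ℕ} (h : N.Reachable m m') (x : P →₀ ℕ) :
    N.Reachable (m + x) (m' + x) :=
  Relation.ReflTransGen.lift (r := fun a b => ∃ t, N.Fires a t b) (· + x)
    (fun _ _ ⟨t, ht⟩ => ⟨t, ht.add_right x⟩) _ _ h

end PetriNet

/-! ### Running cases of a generalized sound workflow net -/

namespace WFNet

variable {P T : Type*} {N : WFNet P T}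

theorem exists_wIn_pos (N : WFNet P T) (t : T) : ∃ p, 0 < N.wIn p t := by
  rcases (N.on_path (Sum.inr t)).1.cases_tail with h | ⟨x | x, -, h⟩
  · cases h
  · exact ⟨x, h⟩
  · exact h.elim

theorem exists_wOut_pos (N : WFNet P T) (t : T) : ∃ p, 0 < N.wOut t p := by
  rcases (N.on_path (Sum.inr t)).2.cases_head with h | ⟨x | x, h, -⟩
  · cases h
  · exact ⟨x, h⟩
  · exact h.elim

/-- A path to `t` leaves the source, whereas no arc leaves the sink. Without a transition the two
places could coincide. -/
theorem source_ne_sink (N : WFNet P T) (t : T) : N.source ≠ N.sink := by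
  intro hs
  rcases (N.on_path (Sum.inr t)).1.cases_head with h | ⟨x | x, h, -⟩
  · cases h
  · exact h
  · have : 0 < N.wIn N.source x := h
    rw [hs, N.sink_postset] at this
    exact this.false

/-- Tokens in the sink are never consumed, hence may be removed beforehand. -/
theorem exists_reachable_of_add_sink {m m' : P →₀ ℕ} {j : ℕ}
    (h : N.Reachable (m + Finsupp.single N.sink j) m') :
    ∃ n, m' = n + Finsupp.single N.sink j ∧ N.Reachable m n := by
  classical
  induction h with
  | refl => exact ⟨m, rfl, .refl⟩
  | @tail b m' _ hs ih =>
    obtain ⟨n, rfl, hn⟩ := ih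
    obtain ⟨t, ht, he⟩ := hs
    have hle : Finsupp.single N.sink j ≤ m' := by
      intro q
      have := he q
      by_cases hq : q = N.sink
      · subst hq
        simp only [Finsupp.add_apply, Finsupp.single_eq_same, N.sink_postset] at this ⊢
        omega
      · simp [Ne.symm hq]
    obtain ⟨n', rfl⟩ := exists_add_of_le hle
    refine ⟨n', add_comm _ _, hn.tail ⟨t, fun q => ?_, fun q => ?_⟩⟩
    · by_cases hq : q = N.sink
      · subst hq
        simp [N.sink_postset]
      · simpa [Finsupp.single_apply, Ne.symm hq] using ht q
    · have := he q
      simp only [Finsupp.add_apply] at this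
      omega

theorem eq_of_reachable_single_sink {j : ℕ} {m : P →₀ ℕ}
    (h : N.Reachable (Finsupp.single N.sink j) m) : m = Finsupp.single N.sink j := by
  classical
  rcases h.cases_head with h | ⟨b, ⟨t, ht, -⟩, -⟩
  · exact h.symm
  · obtain ⟨q, hq⟩ := N.exists_wIn_pos t
    have h1 := ht q
    have hqs : q ≠ N.sink := by
      rintro rfl
      simp [N.sink_postset] at hq
    simp only [Finsupp.single_apply, Ne.symm hqs, if_false] at h1
    omega

/-- `m` is a marking that may arise from `k` cases that are still running, when the tokens of
other, completed cases have been taken from the sink. -/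
def Running (N : WFNet P T) (k : ℕ) (m : P →₀ ℕ) : Prop :=
  ∃ j, N.Reachable (Finsupp.single N.source (k + j)) (m + Finsupp.single N.sink j)

namespace Running

variable {k : ℕ} {m : P →₀ ℕ}

theorem source (N : WFNet P T) (k : ℕ) : N.Running k (Finsupp.single N.source k) :=
  ⟨0, by rw [add_zero, Finsupp.single_zero, add_zero]; exact .refl⟩

theorem sink (hN : N.GeneralizedSound) (k : ℕ) : N.Running k (Finsupp.single N.sink k) :=
  ⟨0, by simpa using (hN k).2.1 _ .refl⟩

theorem fires (h : N.Running k m) {t : T} {m' : P →₀ ℕ} (ht : N.Fires m t m') :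
    N.Running k m' := by
  obtain ⟨j, hj⟩ := h
  exact ⟨j, hj.tail ⟨t, ht.add_right _⟩⟩

/-- Weak termination completes all `k + j` cases; the `j` tokens already in the sink take no part in
that run and can be dropped. -/
theorem reachable_sink (hN : N.GeneralizedSound) (h : N.Running k m) :
    N.Reachable m (Finsupp.single N.sink k) := by
  obtain ⟨j, hj⟩ := h
  obtain ⟨n, hn, hr⟩ := exists_reachable_of_add_sink ((hN _).2.1 _ hj)
  rw [Finsupp.single_add] at hn
  rwa [add_right_cancel hn]

/-- Sink tokens persist along the completing run, which ends with exactly `k` of them. -/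
theorem le_of_single_le (hN : N.GeneralizedSound) (h : N.Running k m) {a : ℕ}
    (ha : Finsupp.single N.sink a ≤ m) : a ≤ k := by
  obtain ⟨m, rfl⟩ := exists_add_of_le ha
  have hr := h.reachable_sink hN
  rw [add_comm] at hr
  obtain ⟨n, hn, -⟩ := exists_reachable_of_add_sink hr
  have := DFunLike.congr_fun hn N.sink
  simp at this
  omega

/-- Nothing fires from the empty marking, so its completion is empty; conversely, once all `j` cases
are in the sink, proper completion excludes leftovers. -/
theorem eq_zero_iff (hN : N.GeneralizedSound) (h : N.Running k m) : m = 0 ↔ k = 0 := by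
  constructor
  · rintro rfl
    have hr := h.reachable_sink hN
    have := eq_of_reachable_single_sink (N := N) (j := 0) (by simpa using hr)
    simpa using this
  · rintro rfl
    obtain ⟨j, hj⟩ := h
    rw [zero_add] at hj
    simpa using (hN j).1 _ hj (by simp)

/-- This is the effect of an outer transition on one colour: `a` tokens leave the sink and `b` enter
the source. The departed tokens join the `j` removed ones, and the new cases may be placed in the
source before the run starts. -/
theorem exchange (h : N.Running k m) {k' a b : ℕ} {m' : P →₀ ℕ}
    (hk : k' + a = k + b)
    (hm : m' + Finsupp.single N.sink a = m + Finsupp.single N.source b) :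
    N.Running k' m' := by
  obtain ⟨j, hj⟩ := h
  refine ⟨a + j, ?_⟩
  have h1 := hj.add_right (Finsupp.single N.source b)
  rw [← Finsupp.single_add, add_right_comm m, ← hm, add_assoc m', ← Finsupp.single_add] at h1
  rwa [show k' + (a + j) = k + j + b by omega]

end Running

end WFNet

/-! ### Bindings -/

section Bindings

variable {I Λ V : Type*} {D : IdTyping I Λ V}

theorem IdTyping.mem_dom_iff (D : IdTyping I Λ V) {i : I} {l : Λ} :
    i ∈ D.dom l ↔ D.typeI i = l :=
  ⟨fun h => D.dom_disjoint _ _ ⟨i, D.mem_dom i, h⟩, fun h => h ▸ D.mem_dom i⟩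

/-- A finite injective type-respecting assignment extends to a substitution. -/
theorem IdTyping.exists_isSubst [Countable V] (D : IdTyping I Λ V) (S : Finset V) (f : V → I)
    (hinj : Set.InjOn f S) (htype : ∀ v ∈ S, D.typeV v = D.typeI (f v)) :
    ∃ ψ, D.IsSubst ψ ∧ ∀ v ∈ S, ψ v = f v := by
  classical
  -- Off `S`, variables of type `l` are sent injectively to identifiers of type `l` not used by `f`;
  -- different types cannot collide because the domains are disjoint.
  have key : ∀ l, ∃ g : V → I, Function.Injective g ∧ ∀ v, g v ∈ D.dom l \ (S.image f : Finset I) := by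
    intro l
    have hinf : (D.dom l \ ((S.image f : Finset I) : Set I)).Infinite :=
      (D.dom_infinite l).sdiff (Finset.finite_toSet _)
    obtain ⟨e, he⟩ := exists_injective_nat V
    exact ⟨fun v => hinf.natEmbedding _ (e v),
      fun v w h => he ((hinf.natEmbedding _).injective (Subtype.ext h)),
      fun v => (hinf.natEmbedding _ (e v)).2⟩
  choose g ginj gmem using key
  refine ⟨fun v => if v ∈ S then f v else g (D.typeV v) v, ⟨?_, fun v => ?_⟩, fun v hv => by simp [hv]⟩
  · intro v w h
    dsimp only at h
    split_ifs at h with hv hw hw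
    · exact hinj hv hw h
    · exact ((gmem (D.typeV w) w).2 (h ▸ by simpa using ⟨v, hv, rfl⟩)).elim
    · exact ((gmem (D.typeV v) v).2 (h ▸ by simpa using ⟨w, hw, rfl⟩)).elim
    · have hvt := D.mem_dom_iff.1 (gmem (D.typeV v) v).1
      have hwt := D.mem_dom_iff.1 (gmem (D.typeV w) w).1
      have ht : D.typeV v = D.typeV w := by rw [← hvt, h, hwt]
      rw [ht] at h
      exact ginj _ h
  · dsimp only
    split_ifs with hv
    · exact htype v hv
    · exact (D.mem_dom_iff.1 (gmem (D.typeV v) v).1).symm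

/-- Applying a substitution to a renamed vector of the same type is again a substitution
instance of the original vector. -/
theorem IdTyping.exists_isSubst_rename [Countable V] {μ : List V} {r : V → V}
    (hr : Function.Injective r) (ht : (μ.map r).map D.typeV = μ.map D.typeV) {ψ : V → I}
    (hψ : D.IsSubst ψ) : ∃ χ, D.IsSubst χ ∧ (μ.map r).map ψ = μ.map χ := by
  classical
  rw [List.map_map, List.map_inj_left] at ht
  obtain ⟨χ, hχ, h⟩ := D.exists_isSubst μ.toFinset (ψ ∘ r) (hψ.1.comp hr).injOn
    (fun v hv => by rw [← ht v (by simpa using hv)]; exact hψ.2 _)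
  refine ⟨χ, hχ, ?_⟩
  rw [List.map_map, List.map_inj_left]
  exact fun v hv => (h v (by simpa using hv)).symm

end Bindings

/-! ### Markings of the workflow refinement, colour by colour -/

section Refinement

/-- The tokens `c` in the places of the refining net. -/
noncomputable def colorMarking {X PN C : Type*} [Finite PN] [DecidableEq C] (F : X ⊕ PN → Multiset C)
    (c : C) : PN →₀ ℕ :=
  Finsupp.equivFunOnFinite.symm fun q => (F (Sum.inr q)).count c

@[simp]
theorem colorMarking_apply {X PN C : Type*} [Finite PN] [DecidableEq C] (F : X ⊕ PN → Multiset C)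
    (c : C) (q : PN) : colorMarking F c q = (F (Sum.inr q)).count c :=
  rfl

theorem substVectors_replicate {V I : Type*} (ψ : V → I) (n : ℕ) (μ : List V) :
    substVectors ψ (Multiset.replicate n μ) = Multiset.replicate n (μ.map ψ) :=
  Multiset.map_replicate _ _ _

@[simp]
theorem substVectors_zero {V I : Type*} (ψ : V → I) : substVectors ψ 0 = 0 :=
  Multiset.map_zero _

namespace TPNID

variable {I Λ V : Type*} {D : IdTyping I Λ V} {PL TL PN TN : Type*}
  {L : TPNID D PL TL} {p : PL} {N : WFNet PN TN} {μ : List V}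
  {hμ : μ.map D.typeV = L.placeType p}

theorem Enabled.exists_fires {P T : Type*} {L : TPNID D P T} {M : P → Multiset (List I)} {t : T}
    {ψ : V → I} (h : L.Enabled M t ψ) : ∃ M', L.Fires M t ψ M' := by
  classical
  refine ⟨fun q => M q - substVectors ψ (L.βIn q t) + substVectors ψ (L.βOut t q), h, fun q => ?_⟩
  dsimp only
  rw [add_right_comm, tsub_add_cancel_of_le (h.2 q)]

theorem Live.of_reachable {P T : Type*} {L : TPNID D P T} {M M' : P → Multiset (List I)}
    (h : L.Live M) (hr : L.Reachable M M') : L.Live M' :=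
  fun _ hr' => h _ (hr.trans hr')

/-- In a live net, a place with an outgoing arc also has an incoming arc. -/
theorem Live.exists_βOut_ne_zero {P T : Type*} {L : TPNID D P T} {M : P → Multiset (List I)}
    (h : L.Live M) {p : P} (hp : ∃ t, L.βIn p t ≠ 0 ∨ L.βOut t p ≠ 0) : ∃ t, L.βOut t p ≠ 0 := by
  by_contra! hout
  obtain ⟨t, ht⟩ := hp
  replace ht := ht.resolve_right (not_not.2 (hout t))
  -- Without incoming arcs the number of tokens in `p` never grows, yet each firing of `t` lowers it
  -- and liveness allows `t` to fire again and again.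
  have step : ∀ {A B : P → Multiset (List I)} {s ψ}, L.Fires A s ψ B →
      (B p).card + (L.βIn p s).card = (A p).card := by
    intro A B s ψ hs
    have := congrArg Multiset.card (hs.2 p)
    simpa [hout s, substVectors] using this
  have mono : ∀ {A B : P → Multiset (List I)}, L.Reachable A B → (B p).card ≤ (A p).card := by
    intro A B hr
    induction hr with
    | refl => exact le_rfl
    | tail _ hs ih =>
      obtain ⟨s, ψ, hs⟩ := hs
      have := step hs
      omega
  have key : ∀ n, ∀ A : P → Multiset (List I), L.Live A → (A p).card ≤ n → False := by
    intro n
    induction n with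
    | zero =>
      intro A hA hn
      obtain ⟨B, ψ, hr, hB⟩ := hA A .refl t
      obtain ⟨B', hB'⟩ := hB.exists_fires
      have h1 := mono hr
      have h2 := step hB'
      have h3 := Multiset.card_pos.2 ht
      omega
    | succ n ih =>
      intro A hA hn
      obtain ⟨B, ψ, hr, hB⟩ := hA A .refl t
      obtain ⟨B', hB'⟩ := hB.exists_fires
      have h1 := mono hr
      have h2 := step hB'
      have h3 := Multiset.card_pos.2 ht
      exact ih B' (hA.of_reachable (hr.tail ⟨_, _, hB'⟩)) (by omega)
  exact key _ M h le_rfl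

theorem wfRefine_inVar_inl (t : TL) : (L.wfRefine p N μ hμ).inVar (Sum.inl t) = L.inVar t := by
  classical
  ext v
  constructor
  · rintro ⟨q | q, x, hx, hv⟩
    · exact ⟨_, x, hx, hv⟩
    · dsimp only [wfRefine] at hx
      split_ifs at hx
      · exact ⟨_, x, hx, hv⟩
      · simp at hx
  · rintro ⟨q, x, hx, hv⟩
    by_cases hq : q = p
    · subst hq
      exact ⟨Sum.inr N.sink, x, by simpa [wfRefine] using hx, hv⟩
    · exact ⟨Sum.inl ⟨q, hq⟩, x, hx, hv⟩

theorem wfRefine_outVar_inl (t : TL) : (L.wfRefine p N μ hμ).outVar (Sum.inl t) = L.outVar t := by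
  classical
  ext v
  constructor
  · rintro ⟨q | q, x, hx, hv⟩
    · exact ⟨_, x, hx, hv⟩
    · dsimp only [wfRefine] at hx
      split_ifs at hx
      · exact ⟨_, x, hx, hv⟩
      · simp at hx
  · rintro ⟨q, x, hx, hv⟩
    by_cases hq : q = p
    · subst hq
      exact ⟨Sum.inr N.source, x, by simpa [wfRefine] using hx, hv⟩
    · exact ⟨Sum.inl ⟨q, hq⟩, x, hx, hv⟩

theorem wfRefine_inVar_inr (t : TN) :
    (L.wfRefine p N μ hμ).inVar (Sum.inr t) = {v | v ∈ μ} := by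
  ext v
  constructor
  · rintro ⟨q | q, x, hx, hv⟩
    · simp [wfRefine] at hx
    · exact Multiset.eq_of_mem_replicate hx ▸ hv
  · intro hv
    obtain ⟨q, hq⟩ := N.exists_wIn_pos t
    exact ⟨Sum.inr q, μ, Multiset.mem_replicate.2 ⟨hq.ne', rfl⟩, hv⟩

theorem wfRefine_outVar_inr (t : TN) :
    (L.wfRefine p N μ hμ).outVar (Sum.inr t) = {v | v ∈ μ} := by
  ext v
  constructor
  · rintro ⟨q | q, x, hx, hv⟩
    · simp [wfRefine] at hx
    · exact Multiset.eq_of_mem_replicate hx ▸ hv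
  · intro hv
    obtain ⟨q, hq⟩ := N.exists_wOut_pos t
    exact ⟨Sum.inr q, μ, Multiset.mem_replicate.2 ⟨hq.ne', rfl⟩, hv⟩

theorem wfRefine_delVar_inl (t : TL) :
    (L.wfRefine p N μ hμ).delVar (Sum.inl t) = L.delVar t := by
  rw [delVar, delVar, wfRefine_inVar_inl, wfRefine_outVar_inl]

/-- Every transition of `N` has both an input and an output arc, so the variables of `μ` occur on
both sides. -/
theorem wfRefine_delVar_inr (t : TN) : (L.wfRefine p N μ hμ).delVar (Sum.inr t) = ∅ := by
  rw [delVar, wfRefine_inVar_inr, wfRefine_outVar_inr, Set.sdiff_self]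

theorem wfRefine_isBinding_inl_iff {F : {q : PL // q ≠ p} ⊕ PN → Multiset (List I)}
    {M : PL → Multiset (List I)} (h : ids F = ids M) (t : TL) (ψ : V → I) :
    (L.wfRefine p N μ hμ).IsBinding F (Sum.inl t) ψ ↔ L.IsBinding M t ψ := by
  simp only [IsBinding, var, newVar, wfRefine_inVar_inl, wfRefine_outVar_inl, h]

theorem wfRefine_objectTypes : (L.wfRefine p N μ hμ).objectTypes = L.objectTypes := by
  ext l
  constructor
  · rintro ⟨q | q, h⟩
    · exact ⟨_, h⟩
    · exact ⟨p, h⟩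
  · rintro ⟨q, h⟩
    by_cases hq : q = p
    · subst hq
      exact ⟨Sum.inr N.source, h⟩
    · exact ⟨Sum.inl ⟨q, hq⟩, h⟩

theorem Fires.outer_of_inr {F F' : {q : PL // q ≠ p} ⊕ PN → Multiset (List I)} {t : TN}
    {ψ : V → I} (h : (L.wfRefine p N μ hμ).Fires F (Sum.inr t) ψ F') (q : {q : PL // q ≠ p}) :
    F' (Sum.inl q) = F (Sum.inl q) := by
  simpa [wfRefine] using h.2 (Sum.inl q)

variable [Finite PN] [DecidableEq I]

theorem wfRefine_enabled_inr_iff {F : {q : PL // q ≠ p} ⊕ PN → Multiset (List I)} {t : TN}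
    {ψ : V → I} (hψ : D.IsSubst ψ) :
    (L.wfRefine p N μ hμ).Enabled F (Sum.inr t) ψ ↔
      N.Enabled (colorMarking F (μ.map ψ)) t := by
  classical
  constructor
  · intro h q
    have := h.2 (Sum.inr q)
    dsimp only [wfRefine] at this
    rwa [substVectors_replicate, ← Multiset.le_count_iff_replicate_le] at this
  · intro h
    refine ⟨⟨hψ, ?_⟩, ?_⟩
    -- There are no emitting variables, and a consumed token shows that all identifiers of `μ.map ψ`
    -- are already present.
    · intro v hv
      simp only [var, newVar, wfRefine_inVar_inr, wfRefine_outVar_inr, Set.union_self,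
        Set.sdiff_self, Set.mem_ofPred_eq] at hv ⊢
      simp only [Set.mem_empty_iff_false, iff_false, not_not]
      obtain ⟨q, hq⟩ := N.exists_wIn_pos t
      exact ⟨Sum.inr q, μ.map ψ, Multiset.count_pos.1 (hq.trans_le (h q)), List.mem_map_of_mem hv⟩
    · rintro (q | q)
      · simp [wfRefine]
      · dsimp only [wfRefine]
        rw [substVectors_replicate, ← Multiset.le_count_iff_replicate_le]
        exact h q

theorem Fires.colorMarking_of_inr {F F' : {q : PL // q ≠ p} ⊕ PN → Multiset (List I)} {t : TN}
    {ψ : V → I} (h : (L.wfRefine p N μ hμ).Fires F (Sum.inr t) ψ F') :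
    N.Fires (colorMarking F (μ.map ψ)) t (colorMarking F' (μ.map ψ)) := by
  classical
  refine ⟨(wfRefine_enabled_inr_iff h.1.1.1).1 h.1, fun q => ?_⟩
  have := congrArg (Multiset.count (μ.map ψ)) (h.2 (Sum.inr q))
  simpa [wfRefine, substVectors_replicate] using this

theorem Fires.colorMarking_of_inr_of_ne {F F' : {q : PL // q ≠ p} ⊕ PN → Multiset (List I)}
    {t : TN} {ψ : V → I} (h : (L.wfRefine p N μ hμ).Fires F (Sum.inr t) ψ F') {c : List I}
    (hc : c ≠ μ.map ψ) : colorMarking F' c = colorMarking F c := by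
  classical
  ext q
  have := congrArg (Multiset.count c) (h.2 (Sum.inr q))
  simpa [wfRefine, substVectors_replicate, Multiset.count_replicate, hc.symm] using this

/-- Firing sequences of the refining net can be followed by the tokens of a single colour. -/
theorem wfRefine_exists_reachable_color {F : {q : PL // q ≠ p} ⊕ PN → Multiset (List I)}
    {ψ : V → I} (hψ : D.IsSubst ψ) {m : PN →₀ ℕ}
    (h : N.Reachable (colorMarking F (μ.map ψ)) m) :
    ∃ F', (L.wfRefine p N μ hμ).Reachable F F' ∧ (∀ q, F' (Sum.inl q) = F (Sum.inl q)) ∧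
      colorMarking F' (μ.map ψ) = m ∧
      ∀ c, c ≠ μ.map ψ → colorMarking F' c = colorMarking F c := by
  induction h with
  | refl => exact ⟨F, .refl, fun _ => rfl, rfl, fun _ _ => rfl⟩
  | tail _ hs ih =>
    obtain ⟨F₁, hr, hout, rfl, hne⟩ := ih
    obtain ⟨t, ht, he⟩ := hs
    obtain ⟨F', hF'⟩ := ((wfRefine_enabled_inr_iff (L := L) (hμ := hμ) hψ).2 ht).exists_fires
    refine ⟨F', hr.tail ⟨_, _, hF'⟩, fun q => (hF'.outer_of_inr q).trans (hout q), ?_,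
      fun c hc => (hF'.colorMarking_of_inr_of_ne hc).trans (hne c hc)⟩
    ext q
    have h1 := hF'.colorMarking_of_inr.2 q
    have h2 := he q
    omega

/-! ### The simulation relation -/

/-- `F` is a marking of the refinement that represents `M`: for every token `c`, the tokens `c`
of `p` correspond to running cases of the refining net. -/
structure Represents (p : PL) (N : WFNet PN TN) (D : IdTyping I Λ V) (μ : List V)
    (F : {q : PL // q ≠ p} ⊕ PN → Multiset (List I)) (M : PL → Multiset (List I)) : Prop where
  outer : ∀ q, F (Sum.inl q) = M q.1
  token : ∀ c ∈ M p, ∃ ψ, D.IsSubst ψ ∧ c = μ.map ψ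
  inner : ∀ c, N.Running ((M p).count c) (colorMarking F c)

theorem represents_wfRefineMarking {M : PL → Multiset (List I)}
    (hMp : ∀ c ∈ M p, ∃ ψ : V → I, D.IsSubst ψ ∧ c = μ.map ψ) :
    Represents p N D μ (wfRefineMarking p N M) M := by
  classical
  refine ⟨fun _ => rfl, hMp, fun c => ?_⟩
  convert WFNet.Running.source N ((M p).count c)
  ext q
  by_cases hq : q = N.source
  · subst hq
    simp [wfRefineMarking]
  · simp [wfRefineMarking, hq]

namespace Represents

variable {F F' : {q : PL // q ≠ p} ⊕ PN → Multiset (List I)} {M M' : PL → Multiset (List I)}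

theorem ids_eq (hN : N.GeneralizedSound) (h : Represents p N D μ F M) : ids F = ids M := by
  classical
  ext i
  constructor
  · rintro ⟨q | q, c, hc, hi⟩
    · exact ⟨q.1, c, h.outer q ▸ hc, hi⟩
    · refine ⟨p, c, ?_, hi⟩
      rw [← Multiset.count_ne_zero, Ne, ← (h.inner c).eq_zero_iff hN]
      intro h0
      have := DFunLike.congr_fun h0 q
      simp only [colorMarking_apply, Finsupp.zero_apply, Multiset.count_eq_zero] at this
      exact this hc
  · rintro ⟨q, c, hc, hi⟩
    by_cases hq : q = p
    · subst hq
      rw [← Multiset.count_ne_zero, Ne, ← (h.inner c).eq_zero_iff hN] at hc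
      obtain ⟨q', hq'⟩ := DFunLike.ne_iff.1 hc
      exact ⟨Sum.inr q', c, Multiset.count_ne_zero.1 hq', hi⟩
    · exact ⟨Sum.inl ⟨q, hq⟩, c, (h.outer ⟨q, hq⟩).symm ▸ hc, hi⟩

theorem fires_inr (h : Represents p N D μ F M) {t : TN} {ψ : V → I}
    (hF : (L.wfRefine p N μ hμ).Fires F (Sum.inr t) ψ F') : Represents p N D μ F' M := by
  refine ⟨fun q => (hF.outer_of_inr q).trans (h.outer q), h.token, fun c => ?_⟩
  by_cases hc : c = μ.map ψ
  · subst hc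
    exact (h.inner _).fires hF.colorMarking_of_inr
  · rw [hF.colorMarking_of_inr_of_ne hc]
    exact h.inner c

/-- What `t` takes from the sink is, colour by colour, at most the number of running cases, hence
available in `p`. -/
theorem enabled_of_inl (hN : N.GeneralizedSound) (h : Represents p N D μ F M) {t : TL}
    {ψ : V → I} (hF : (L.wfRefine p N μ hμ).Enabled F (Sum.inl t) ψ) : L.Enabled M t ψ := by
  classical
  refine ⟨(wfRefine_isBinding_inl_iff (h.ids_eq hN) t ψ).1 hF.1, fun q => ?_⟩
  by_cases hq : q = p
  · subst hq
    refine Multiset.le_iff_count.2 fun c => (h.inner c).le_of_single_le hN ?_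
    have hle := hF.2 (Sum.inr N.sink)
    simp only [wfRefine, if_true] at hle
    intro q'
    by_cases hq' : q' = N.sink
    · subst hq'
      simpa using Multiset.count_le_of_le c hle
    · simp [Ne.symm hq']
  · rw [← h.outer ⟨q, hq⟩]
    exact hF.2 (Sum.inl ⟨q, hq⟩)

theorem of_fires [Countable V] (hμ : μ.map D.typeV = L.placeType p)
    (hβ : ∀ t, ∀ x ∈ L.βOut t p, ∃ r : V → V, Function.Injective r ∧ x = μ.map r)
    (h : Represents p N D μ F M) {t : TL} {ψ : V → I}
    (hF : (L.wfRefine p N μ hμ).Fires F (Sum.inl t) ψ F') (hM : L.Fires M t ψ M') :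
    Represents p N D μ F' M' := by
  classical
  refine ⟨fun q => ?_, fun c hc => ?_, fun c => ?_⟩
  · have h1 := hF.2 (Sum.inl q)
    rw [h.outer q] at h1
    exact add_right_cancel (h1.trans (hM.2 q.1).symm)
  · have hc' : c ∈ M p + substVectors ψ (L.βOut t p) := by
      rw [← hM.2 p]
      exact Multiset.mem_add.2 (Or.inl hc)
    rcases Multiset.mem_add.1 hc' with hc' | hc'
    · exact h.token c hc'
    · obtain ⟨x, hx, rfl⟩ := Multiset.mem_map.1 hc'
      obtain ⟨r, hr, rfl⟩ := hβ t x hx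
      exact IdTyping.exists_isSubst_rename hr ((L.βOut_type t p _ hx).trans hμ.symm) hM.1.1.1
  -- For each colour, the balances at `p` in `L` and at the places of `N` are the two hypotheses of
  -- `exchange`.
  · have hp := congrArg (Multiset.count c) (hM.2 p)
    rw [Multiset.count_add, Multiset.count_add] at hp
    refine (h.inner c).exchange hp ?_
    ext q
    have hq := congrArg (Multiset.count c) (hF.2 (Sum.inr q))
    simp only [wfRefine, Multiset.count_add] at hq
    simp only [Finsupp.add_apply, colorMarking_apply, Finsupp.single_apply, eq_comm (b := q)]
    convert hq using 2 <;> split_ifs <;> simp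

/-- Outer steps are copied in `L`; inner steps are matched by no step at all. -/
theorem exists_reachable [Countable V] (hN : N.GeneralizedSound)
    (hβ : ∀ t, ∀ x ∈ L.βOut t p, ∃ r : V → V, Function.Injective r ∧ x = μ.map r)
    (h : Represents p N D μ F M) (hF : (L.wfRefine p N μ hμ).Reachable F F') :
    ∃ M', L.Reachable M M' ∧ Represents p N D μ F' M' := by
  induction hF with
  | refl => exact ⟨M, .refl, h⟩
  | tail _ hs ih =>
    obtain ⟨M₁, hr, h₁⟩ := ih
    obtain ⟨t | t, ψ, hs⟩ := hs
    · obtain ⟨M', hM'⟩ := (h₁.enabled_of_inl hN hs.1).exists_fires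
      exact ⟨M', hr.tail ⟨t, ψ, hM'⟩, h₁.of_fires hμ hβ hs hM'⟩
    · exact ⟨M₁, hr, h₁.fires_inr hs⟩

/-- All running cases of the refining net can be completed. -/
theorem exists_reachable_completed (hN : N.GeneralizedSound) (h : Represents p N D μ F M) :
    ∃ F', (L.wfRefine p N μ hμ).Reachable F F' ∧ Represents p N D μ F' M ∧
      M p ≤ F' (Sum.inr N.sink) := by
  classical
  -- Colours are completed one at a time, since completing one leaves the others untouched.
  have key : ∀ S : Finset (List I), (∀ c ∈ S, c ∈ M p) →
      ∃ F', (L.wfRefine p N μ hμ).Reachable F F' ∧ Represents p N D μ F' M ∧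
        ∀ c ∈ S, colorMarking F' c = Finsupp.single N.sink ((M p).count c) := by
    intro S
    induction S using Finset.induction_on with
    | empty => exact fun _ => ⟨F, .refl, h, by simp⟩
    | insert c S hcS ih =>
      intro hS
      obtain ⟨F₁, hr, h₁, hS₁⟩ := ih fun d hd => hS d (Finset.mem_insert_of_mem hd)
      obtain ⟨ψ, hψ, rfl⟩ := h.token c (hS c (Finset.mem_insert_self _ _))
      obtain ⟨F', hr', hout, hcol, hne⟩ := wfRefine_exists_reachable_color (L := L) (hμ := hμ) hψ
        ((h₁.inner (μ.map ψ)).reachable_sink hN)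
      refine ⟨F', hr.trans hr', ⟨fun q => (hout q).trans (h₁.outer q), h.token, fun d => ?_⟩,
        fun d hd => ?_⟩
      · by_cases hd : d = μ.map ψ
        · subst hd
          rw [hcol]
          exact .sink hN _
        · rw [hne d hd]
          exact h₁.inner d
      · by_cases hd' : d = μ.map ψ
        · rw [hd', hcol]
        · rw [hne d hd']
          exact hS₁ d (Finset.mem_of_mem_insert_of_ne hd hd')
  obtain ⟨F', hr, h', hS⟩ := key (M p).toFinset fun c hc => Multiset.mem_toFinset.1 hc
  refine ⟨F', hr, h', Multiset.le_iff_count.2 fun c => ?_⟩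
  by_cases hc : c ∈ M p
  · have := DFunLike.congr_fun (hS c (Multiset.mem_toFinset.2 hc)) N.sink
    rw [Finsupp.single_eq_same, colorMarking_apply] at this
    exact this.ge
  · simp [Multiset.count_eq_zero.2 hc]

theorem enabled_inl (hN : N.GeneralizedSound) (h : Represents p N D μ F M)
    (hsink : M p ≤ F (Sum.inr N.sink)) {t : TL} {ψ : V → I} (hM : L.Enabled M t ψ) :
    (L.wfRefine p N μ hμ).Enabled F (Sum.inl t) ψ := by
  classical
  refine ⟨(wfRefine_isBinding_inl_iff (h.ids_eq hN) t ψ).2 hM.1, ?_⟩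
  rintro (q | q)
  · rw [h.outer q]
    exact hM.2 q.1
  · dsimp only [wfRefine]
    split_ifs with hq
    · subst hq
      exact (hM.2 p).trans hsink
    · simp

theorem exists_reachable_enabled (hN : N.GeneralizedSound) (h : Represents p N D μ F M)
    {t : TL} {ψ : V → I} (hM : L.Enabled M t ψ) :
    ∃ F', (L.wfRefine p N μ hμ).Reachable F F' ∧ Represents p N D μ F' M ∧
      (L.wfRefine p N μ hμ).Enabled F' (Sum.inl t) ψ := by
  obtain ⟨F', hr, h', hs⟩ := h.exists_reachable_completed (L := L) (hμ := hμ) hN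
  exact ⟨F', hr, h', h'.enabled_inl hN hs hM⟩

/-- Before each step of `L` is copied, the running cases are completed so that the tokens of `p` are
in the sink. -/
theorem exists_represented_reachable [Countable V] (hN : N.GeneralizedSound)
    (hβ : ∀ t, ∀ x ∈ L.βOut t p, ∃ r : V → V, Function.Injective r ∧ x = μ.map r)
    (h : Represents p N D μ F M) (hM : L.Reachable M M') :
    ∃ F', (L.wfRefine p N μ hμ).Reachable F F' ∧ Represents p N D μ F' M' := by
  induction hM with
  | refl => exact ⟨F, .refl, h⟩
  | tail _ hs ih =>
    obtain ⟨F₁, hr, h₁⟩ := ih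
    obtain ⟨t, ψ, hs⟩ := hs
    obtain ⟨F₂, hr₂, h₂, hen⟩ := h₁.exists_reachable_enabled (hμ := hμ) hN hs.1
    obtain ⟨F', hF'⟩ := hen.exists_fires
    exact ⟨F', (hr.trans hr₂).tail ⟨_, _, hF'⟩, h₂.of_fires hμ hβ hF' hs⟩

end Represents

/-! ### Liveness and identifier soundness -/

section

variable [Countable V] {F : {q : PL // q ≠ p} ⊕ PN → Multiset (List I)}
  {M : PL → Multiset (List I)}

theorem Represents.live_wfRefine (hp : ∃ t, L.βIn p t ≠ 0 ∨ L.βOut t p ≠ 0)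
    (hN : N.GeneralizedSound)
    (hβ : ∀ t, ∀ x ∈ L.βOut t p, ∃ r : V → V, Function.Injective r ∧ x = μ.map r)
    (h : Represents p N D μ F M) (hL : L.Live M) : (L.wfRefine p N μ hμ).Live F := by
  classical
  intro F₁ hF₁ t
  obtain ⟨M₁, hM₁, h₁⟩ := h.exists_reachable hN hβ hF₁
  have reach : ∀ t : TL, ∃ F₂ ψ M₂, (L.wfRefine p N μ hμ).Reachable F₁ F₂ ∧
      Represents p N D μ F₂ M₂ ∧ L.Enabled M₂ t ψ ∧
      (L.wfRefine p N μ hμ).Enabled F₂ (Sum.inl t) ψ := by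
    intro t
    obtain ⟨M₂, ψ, hM₂, hen⟩ := hL M₁ hM₁ t
    obtain ⟨F₂, hF₂, h₂⟩ := h₁.exists_represented_reachable (hμ := hμ) hN hβ hM₂
    obtain ⟨F₃, hF₃, h₃, hen'⟩ := h₂.exists_reachable_enabled (hμ := hμ) hN hen
    exact ⟨F₃, ψ, M₂, hF₂.trans hF₃, h₃, hen, hen'⟩
  rcases t with t | t
  · obtain ⟨F₂, ψ, -, hF₂, -, -, hen⟩ := reach t
    exact ⟨F₂, ψ, hF₂, hen⟩
  -- For an inner `t`, some `s` producing into `p` is fired first, which starts a case in the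
  -- source.
  · obtain ⟨s, hs⟩ := hL.exists_βOut_ne_zero hp
    obtain ⟨x, hx⟩ := Multiset.exists_mem_of_ne_zero hs
    obtain ⟨F₂, ψ, M₂, hF₂, h₂, hen, hen'⟩ := reach s
    obtain ⟨F₃, hF₃⟩ := hen'.exists_fires
    obtain ⟨r, hr, rfl⟩ := hβ s x hx
    obtain ⟨χ, hχ, hc⟩ := IdTyping.exists_isSubst_rename hr
      ((L.βOut_type s p _ hx).trans hμ.symm) hen.1.1
    have hle : Finsupp.single N.source 1 ≤ colorMarking F₃ (μ.map χ) := by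
      rw [Finsupp.single_le_iff, colorMarking_apply, Nat.one_le_iff_ne_zero,
        Multiset.count_ne_zero, ← hc]
      have h3 := hF₃.2 (Sum.inr N.source)
      simp only [wfRefine, N.source_ne_sink t, if_false, if_true, substVectors_zero,
        add_zero] at h3
      rw [h3]
      exact Multiset.mem_add.2 (Or.inr (Multiset.mem_map_of_mem _ hx))
    -- The other tokens `y` of this colour are idle while a single case runs to a marking enabling
    -- `t`.
    obtain ⟨y, hy⟩ := exists_add_of_le hle
    obtain ⟨m, hm, hmt⟩ := (hN 1).2.2 t
    have hm' := hm.add_right y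
    rw [← hy] at hm'
    obtain ⟨F₄, hF₄, -, hcol, -⟩ := wfRefine_exists_reachable_color (L := L) (hμ := hμ) hχ hm'
    refine ⟨F₄, χ, (hF₂.tail ⟨_, _, hF₃⟩).trans hF₄, (wfRefine_enabled_inr_iff hχ).2 ?_⟩
    rw [hcol]
    exact fun q => (hmt q).trans (by simp)

theorem Represents.live_of_wfRefine (hN : N.GeneralizedSound)
    (hβ : ∀ t, ∀ x ∈ L.βOut t p, ∃ r : V → V, Function.Injective r ∧ x = μ.map r)
    (h : Represents p N D μ F M) (hR : (L.wfRefine p N μ hμ).Live F) : L.Live M := by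
  intro M₁ hM₁ t
  obtain ⟨F₁, hF₁, h₁⟩ := h.exists_represented_reachable (hμ := hμ) hN hβ hM₁
  obtain ⟨F₂, ψ, hF₂, hen⟩ := hR F₁ hF₁ (Sum.inl t)
  obtain ⟨M₂, hM₂, h₂⟩ := h₁.exists_reachable hN hβ hF₂
  exact ⟨M₂, ψ, hM₂, h₂.enabled_of_inl hN hen⟩

/-- Inner transitions collect nothing, so proper completion concerns only outer ones, and these see
the same identifiers in both nets. -/
theorem Represents.identifierSound_wfRefine (hN : N.GeneralizedSound)
    (hβ : ∀ t, ∀ x ∈ L.βOut t p, ∃ r : V → V, Function.Injective r ∧ x = μ.map r)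
    (h : Represents p N D μ F M) (hL : L.IdentifierSound M) :
    (L.wfRefine p N μ hμ).IdentifierSound F := by
  intro l hl
  rw [wfRefine_objectTypes] at hl
  obtain ⟨hc, hw⟩ := hL l hl
  refine ⟨?_, fun F₁ hF₁ i hil hi => ?_⟩
  · rintro (t | t) ht ψ F₁ F₂ hF₁ - hs i ⟨hi, hi₁⟩ hil
    · obtain ⟨M₁, hM₁, h₁⟩ := h.exists_reachable hN hβ hF₁
      obtain ⟨M₂, hM₂⟩ := (h₁.enabled_of_inl hN hs.1).exists_fires
      rw [(h₁.of_fires hμ hβ hs hM₂).ids_eq hN]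
      rw [h₁.ids_eq hN] at hi₁
      rw [wfRefine_delVar_inl] at hi
      replace ht : t ∈ L.collectors l := by
        obtain ⟨x, hx, hxl⟩ := ht
        exact ⟨x, by rwa [wfRefine_delVar_inl] at hx, hxl⟩
      exact hc t ht ψ M₁ M₂ hM₁ (hM₁.tail ⟨_, _, hM₂⟩) hM₂ i ⟨hi, hi₁⟩ hil
    · simp [wfRefine_delVar_inr] at hi
  · obtain ⟨M₁, hM₁, h₁⟩ := h.exists_reachable hN hβ hF₁
    rw [h₁.ids_eq hN] at hi
    obtain ⟨M₂, hM₂, hi₂⟩ := hw M₁ hM₁ i hil hi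
    obtain ⟨F₂, hF₂, h₂⟩ := h₁.exists_represented_reachable (hμ := hμ) hN hβ hM₂
    exact ⟨F₂, hF₂, by rwa [h₂.ids_eq hN]⟩

theorem Represents.identifierSound_of_wfRefine (hN : N.GeneralizedSound)
    (hβ : ∀ t, ∀ x ∈ L.βOut t p, ∃ r : V → V, Function.Injective r ∧ x = μ.map r)
    (h : Represents p N D μ F M) (hR : (L.wfRefine p N μ hμ).IdentifierSound F) :
    L.IdentifierSound M := by
  intro l hl
  rw [← wfRefine_objectTypes (N := N) (hμ := hμ)] at hl
  obtain ⟨hc, hw⟩ := hR l hl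
  refine ⟨?_, fun M₁ hM₁ i hil hi => ?_⟩
  · rintro t ht ψ M₁ M₂ hM₁ - hs i ⟨hi, hi₁⟩ hil
    obtain ⟨F₀, hF₀, h₀⟩ := h.exists_represented_reachable (hμ := hμ) hN hβ hM₁
    -- The step must be copied in the refinement, where `t` may be enabled only after running cases
    -- complete; this keeps `M₁`, hence the identifiers.
    obtain ⟨F₁, hF₁, h₁, hen⟩ := h₀.exists_reachable_enabled (hμ := hμ) hN hs.1
    obtain ⟨F₂, hF₂⟩ := hen.exists_fires
    rw [← (h₁.of_fires hμ hβ hF₂ hs).ids_eq hN]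
    rw [← h₁.ids_eq hN] at hi₁
    have hr := hF₀.trans hF₁
    refine hc (Sum.inl t) ?_ ψ F₁ F₂ hr (hr.tail ⟨_, _, hF₂⟩) hF₂ i ⟨?_, hi₁⟩ hil
    · obtain ⟨x, hx, hxl⟩ := ht
      exact ⟨x, by rwa [wfRefine_delVar_inl], hxl⟩
    · rwa [wfRefine_delVar_inl]
  · obtain ⟨F₁, hF₁, h₁⟩ := h.exists_represented_reachable (hμ := hμ) hN hβ hM₁
    rw [← h₁.ids_eq hN] at hi
    obtain ⟨F₂, hF₂, hi₂⟩ := hw F₁ hF₁ i hil hi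
    obtain ⟨M₂, hM₂, h₂⟩ := h₁.exists_reachable hN hβ hF₂
    exact ⟨M₂, hM₂, by rwa [← h₂.ids_eq hN]⟩

end

end TPNID

end Refinement

theorem mainTheorem4 {I Λ V : Type*} [Countable I] [Infinite I] [Countable Λ] [Infinite Λ]
    [Countable V] [Infinite V] (D : IdTyping I Λ V)
    {PL TL PN TN : Type*} [Finite PN]
    (L : TPNID D PL TL) (M : PL → Multiset (List I)) (hM : L.IsMarking M)
    (p : PL) (hp : ∃ t, L.βIn p t ≠ 0 ∨ L.βOut t p ≠ 0)
    (N : WFNet PN TN) (hN : N.GeneralizedSound)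
    (μ : List V) (hμ : μ.map D.typeV = L.placeType p)
    (hβ : ∀ t, ∀ x ∈ L.βOut t p, ∃ r : V → V, Function.Injective r ∧ x = μ.map r)
    (hMp : ∀ c ∈ M p, ∃ ψ : V → I, D.IsSubst ψ ∧ c = μ.map ψ) :
    (L.IdentifierSound M ∧ L.Live M) ↔
      ((L.wfRefine p N μ hμ).IdentifierSound (wfRefineMarking p N M) ∧
        (L.wfRefine p N μ hμ).Live (wfRefineMarking p N M)) := by
  classical
  have h := TPNID.represents_wfRefineMarking (p := p) (N := N) hMp
  exact ⟨fun ⟨hs, hl⟩ => ⟨h.identifierSound_wfRefine hN hβ hs, h.live_wfRefine hp hN hβ hl⟩,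
    fun ⟨hs, hl⟩ => ⟨h.identifierSound_of_wfRefine hN hβ hs, h.live_of_wfRefine hN hβ hl⟩⟩
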